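/- For metric spaces $X$ and $Y$, a copy of $Y$ in $X$ is a subset of $X$ that is isometric to $Y$, and $\chi(X,Y)$ denotes the smallest number $c$ such that the points of $X$ can be coloured with $c$ colours without a monochromatic copy of $Y$. Let $\mathbb{R}^n_\infty$ be $\mathbb{R}^n$ with the metric $\|x-y\|_\infty=\max_i|x_i-y_i|$. For an integer $k\ge 1$ and a real $\lambda>0$, let $\mathcal{B}_k(\lambda)=\{0,\lambda,2\lambda,\dots,k\lambda\}\subset\mathbb{R}$ with the metric of $\mathbb{R}$, and equip a Cartesian product of metric spaces with the maximum of the metrics of the factors. Theorem. Let $k,m\ge 1$ be integers and let $\lambda_1,\dots,\lambda_m$ be positive reals. Then $\chi\big(\mathbb{R}^n_\infty,\mathcal{B}_k(\lambda_1)\times\dots\times\mathcal{B}_k(\lambda_m)\big)$ is finite for every $n$, and $$\chi\big(\mathbb{R}^n_\infty,\ \mathcal{B}_k(\lambda_1)\times\dots\times\mathcal{B}_k(\lambda_m)\big)=\left(\frac{k+1}{k}+o(1)\right)^n\qquad (n\to\infty),$$ where $k,m,\lambda_1,\dots,\lambda_m$ are fixed. -/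

import Mathlib

/-- `S` is a copy of the metric space `Y` in `X`: it is the image of a distance-preserving
bijection from `Y`. -/
def IsCopy (Y : Type*) {X : Type*} [MetricSpace X] [MetricSpace Y] (S : Set X) : Prop :=
  Nonempty (Y ≃ᵢ S)

/-- The colouring `f` of `X` has no monochromatic copy of `Y`. -/
def IsProperColouring (Y : Type*) {X C : Type*} [MetricSpace X] [MetricSpace Y]
    (f : X → C) : Prop :=
  ∀ S : Set X, IsCopy Y S → ¬ ∃ c : C, ∀ x ∈ S, f x = c

/-- The chromatic number `χ(X, Y)`: the least number of colours in a colouring of `X` without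
monochromatic copies of `Y`; it is `⊤` if no finite number of colours suffices. -/
noncomputable def chromaticNumber (X Y : Type*) [MetricSpace X] [MetricSpace Y] : ℕ∞ :=
  ⨅ (c : ℕ) (_ : ∃ f : X → Fin c, IsProperColouring Y f), (c : ℕ∞)

/-- The baton `{σ₀, …, σₖ} ⊆ ℝ`, where `σᵢ` is the sum of the first `i` terms of `lam`. -/
def baton {k : ℕ} (lam : Fin k → ℝ) : Set ℝ :=
  Set.range fun i : Fin (k + 1) => ∑ j : Fin k with j.val < i.val, lam j

/-- The baton with `k` equal gaps: the arithmetic progression `{0, lam, 2 * lam, …, k * lam}`. -/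
def arithBaton (k : ℕ) (lam : ℝ) : Set ℝ :=
  baton fun _ : Fin k => lam

/-!
Write `r = (k + 1) / k`; both bounds agree with `r ^ n` up to a factor polynomial in `n`, which
disappears in the `n`-th root.

*Upper bound.* It suffices to avoid one baton of step `l`. Fix words `T₁, …, Tₛ` over `ℤ/(k + 1)`
such that every word differs from some `Tᵢ` in all coordinates, and give `x` a colour `i` for which
`Tᵢ` differs from `⌊x / l⌋` in all coordinates. A sequence of points of one colour with steps of
length at most `l` can never cross, in any coordinate, the cells forbidden by `Tᵢ`, so each
coordinate stays in a half-open interval of length `k * l`, while a baton has diameter `k * l`.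
A random word has the required property for a given one with probability `r⁻¹ ^ n`, so by the union
bound about `r ^ n * log ((k + 1) ^ n)` words are enough.

*Lower bound.* Read words over the alphabet `{0, …, k}^ι` as points of `ℝⁿ` through
`a ↦ ∑ i, a i * lam i`. A set of words of density more than `(n + 1) ^ |ι| * r⁻¹ ^ n` contains a
copy of the product of batons. In the induction on `n`, the first letter runs along the lines of
the alphabet in the direction of the smallest step. Over a word `y`, if some letter of a line is
missing, the `j` letters present on it yield at least `j` pairs of neighbouring letters that meet
the set, out of only `k` pairs; merging such a pair costs nothing in the metric. If no letter is
missing, the line supplies the factor of the product in its direction, and the rest of the product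
is found among the words `y`.
-/

open Filter Topology
open scoped NNReal

section ChromaticNumber

variable {X Y Z C : Type*} [MetricSpace X] [MetricSpace Y] [MetricSpace Z]

theorem isProperColouring_iff_forall_isometry {f : X → C} :
    IsProperColouring Y f ↔ ∀ g : Y → X, Isometry g → ¬ ∃ c, ∀ y, f (g y) = c := by
  constructor
  · rintro hf g hg ⟨c, hc⟩
    exact hf (Set.range g) ⟨hg.isometryEquivOnRange⟩ ⟨c, Set.forall_mem_range.2 hc⟩
  · rintro hf S ⟨e⟩ ⟨c, hc⟩
    exact hf (fun y => e y) (isometry_subtype_coe.comp e.isometry) ⟨c, fun y => hc _ (e y).2⟩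

theorem IsProperColouring.of_isometry {f : X → C} (hf : IsProperColouring Y f) {h : Y → Z}
    (hh : Isometry h) : IsProperColouring Z f := by
  rw [isProperColouring_iff_forall_isometry] at hf ⊢
  rintro g hg ⟨c, hc⟩
  exact hf (g ∘ h) (hg.comp hh) ⟨c, fun y => hc (h y)⟩

theorem chromaticNumber_le {s : ℕ} {f : X → Fin s} (hf : IsProperColouring Y f) :
    chromaticNumber X Y ≤ s :=
  iInf₂_le s ⟨f, hf⟩

theorem exists_isProperColouring_toNat_chromaticNumber (h : chromaticNumber X Y ≠ ⊤) :
    ∃ f : X → Fin (chromaticNumber X Y).toNat, IsProperColouring Y f := by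
  obtain ⟨s, hs⟩ : ∃ s : ℕ, ∃ f : X → Fin s, IsProperColouring Y f := by
    contrapose! h
    exact iInf₂_eq_top.2 fun s hs => absurd hs (by simpa using h s)
  have : Nonempty {s : ℕ // ∃ f : X → Fin s, IsProperColouring Y f} := ⟨⟨s, hs⟩⟩
  obtain ⟨⟨t, ht⟩, heq⟩ :=
    ciInf_mem fun s : {s : ℕ // ∃ f : X → Fin s, IsProperColouring Y f} => (s : ℕ∞)
  have hχ : chromaticNumber X Y = t := by rw [chromaticNumber, iInf_subtype', ← heq]
  rwa [hχ, ENat.toNat_natCast]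

end ChromaticNumber

section Baton

theorem mem_arithBaton_iff {k : ℕ} {l x : ℝ} :
    x ∈ arithBaton k l ↔ ∃ t : Fin (k + 1), (t : ℝ) * l = x := by
  have hcard (t : Fin (k + 1)) : ({j : Fin k | j.val < t.val} : Finset (Fin k)).card = t := by
    rw [Fin.card_filter_val_lt, min_eq_right t.is_le]
  simp [arithBaton, baton, hcard]

theorem isometry_update {ι : Type*} [Fintype ι] [DecidableEq ι] {E : ι → Type*}
    [∀ i, PseudoMetricSpace (E i)] (x : ∀ i, E i) (i : ι) : Isometry (Function.update x i) := by
  refine Isometry.of_dist_eq fun a b => le_antisymm ?_ ?_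
  · refine (dist_pi_le_iff dist_nonneg).2 fun j => ?_
    obtain rfl | hj := eq_or_ne j i
    · simp
    · simp [hj]
  · simpa using dist_le_pi_dist (Function.update x i a) (Function.update x i b) i

theorem exists_isometry_arithBaton_pi {ι : Type*} [Fintype ι] (k : ℕ) (lam : ι → ℝ) (i : ι) :
    ∃ g : arithBaton k (lam i) → (j : ι) → arithBaton k (lam j), Isometry g := by
  classical
  have hzero (j : ι) : (0 : ℝ) ∈ arithBaton k (lam j) := mem_arithBaton_iff.2 ⟨0, by simp⟩
  exact ⟨_, isometry_update (fun j => (⟨0, hzero j⟩ : arithBaton k (lam j))) i⟩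

end Baton

section Counting

/-- The words `y` which the letter `a` or the letter `b` extends to a word of `A`. -/
def mergedFibre {α : Type*} [Fintype α] [DecidableEq α] {n : ℕ} (A : Finset (Fin (n + 1) → α))
    (a b : α) : Finset (Fin n → α) :=
  {y | Matrix.vecCons a y ∈ A ∨ Matrix.vecCons b y ∈ A}

/-- The words `y` which every letter `ℓ t` extends to a word of `A`. -/
def fullFibre {α : Type*} [Fintype α] [DecidableEq α] {k n : ℕ}
    (A : Finset (Fin (n + 1) → α)) (ℓ : Fin (k + 1) → α) : Finset (Fin n → α) :=
  {y | ∀ t, Matrix.vecCons (ℓ t) y ∈ A}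

theorem sum_ite_le_sum_ite_castSucc_or_succ_add {k : ℕ} (C : Fin (k + 1) → Prop)
    [DecidablePred C] :
    (∑ t, if C t then 1 else 0) ≤
      (∑ t : Fin k, if C t.castSucc ∨ C t.succ then 1 else 0) + if ∀ t, C t then 1 else 0 := by
  by_cases hall : ∀ t, C t
  · simp [hall]
  · obtain ⟨s, hs⟩ := not_forall.1 hall
    rw [if_neg hall, add_zero, Fin.sum_univ_succAbove _ s, if_neg hs, zero_add]
    refine Finset.sum_le_sum fun t _ => ?_
    have hpair (h : C (s.succAbove t)) : C t.castSucc ∨ C t.succ := by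
      rw [Fin.succAbove] at h
      split_ifs at h
      exacts [.inl h, .inr h]
    split_ifs <;> simp_all

variable {α β : Type*} [Fintype α] [DecidableEq α] {k n : ℕ}

theorem card_le_sum_card_mergedFibre_add_card_fullFibre [Fintype β]
    (e : Fin (k + 1) × β ≃ α) (A : Finset (Fin (n + 1) → α)) :
    A.card ≤ ∑ b, (∑ t : Fin k, (mergedFibre A (e (t.castSucc, b)) (e (t.succ, b))).card +
      (fullFibre A fun t => e (t, b)).card) := by
  have hA : A.card = ∑ b, ∑ y : Fin n → α, ∑ t,
      if Matrix.vecCons (e (t, b)) y ∈ A then 1 else 0 := by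
    calc A.card = ∑ x : Fin (n + 1) → α, if x ∈ A then 1 else 0 := by simp
      _ = ∑ t, ∑ b, ∑ y : Fin n → α, if Matrix.vecCons (e (t, b)) y ∈ A then 1 else 0 := by
        rw [← (Fin.consEquiv fun _ : Fin (n + 1) => α).sum_comp, Fintype.sum_prod_type,
          ← e.sum_comp, Fintype.sum_prod_type]
        rfl
      _ = _ := by
        rw [Finset.sum_comm]
        exact Finset.sum_congr rfl fun b _ => Finset.sum_comm
  rw [hA]
  refine Finset.sum_le_sum fun b _ => ?_
  simp only [mergedFibre, fullFibre, Finset.card_filter]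
  rw [Finset.sum_comm (s := (Finset.univ : Finset (Fin k))), ← Finset.sum_add_distrib]
  exact Finset.sum_le_sum fun y _ => sum_ite_le_sum_ite_castSucc_or_succ_add _

theorem pow_mul_card_le_of_fibres_le [Finite β] (hk : 0 < k) (e : Fin (k + 1) × β ≃ α)
    {A : Finset (Fin (n + 1) → α)} {s : ℕ}
    (hmerged : ∀ b (t : Fin k),
      (k + 1) ^ n * (mergedFibre A (e (t.castSucc, b)) (e (t.succ, b))).card ≤
        (k * Fintype.card α) ^ n * (n + 1) ^ (s + 1))
    (hfull : ∀ b, (k + 1) ^ n * (fullFibre A fun t => e (t, b)).card ≤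
      (k * Fintype.card α) ^ n * (n + 1) ^ s) :
    (k + 1) ^ (n + 1) * A.card ≤
      (k * Fintype.card α) ^ (n + 1) * (n + 1 + 1) ^ (s + 1) := by
  have := Fintype.ofFinite β
  set N := Fintype.card α
  have hN : N = (k + 1) * Fintype.card β := by simpa using (Fintype.card_congr e).symm
  calc (k + 1) ^ (n + 1) * A.card
      ≤ (k + 1) * ∑ b, (∑ t : Fin k,
          (k + 1) ^ n * (mergedFibre A (e (t.castSucc, b)) (e (t.succ, b))).card +
            (k + 1) ^ n * (fullFibre A fun t => e (t, b)).card) := by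
        simp only [← Finset.mul_sum, ← mul_add, ← mul_assoc, ← pow_succ']
        gcongr
        exact card_le_sum_card_mergedFibre_add_card_fullFibre e A
    _ ≤ (k + 1) * ∑ _b : β,
          (∑ _t : Fin k, (k * N) ^ n * (n + 1) ^ (s + 1) + (k * N) ^ n * (n + 1) ^ s) := by
        refine Nat.mul_le_mul_left _ (Finset.sum_le_sum fun b _ => ?_)
        exact add_le_add (Finset.sum_le_sum fun t _ => hmerged b t) (hfull b)
    _ = N * (k * N) ^ n * (n + 1) ^ s * (k * (n + 1) + 1) := by
        simp only [Finset.sum_const, Finset.card_univ, Fintype.card_fin, smul_eq_mul, hN]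
        ring
    _ ≤ N * (k * N) ^ n * (n + 1 + 1) ^ s * (k * (n + 1 + 1)) := by
        gcongr <;> lia
    _ = (k * N) ^ (n + 1) * (n + 1 + 1) ^ (s + 1) := by ring

end Counting

section GridCopy

variable {ι α : Type*} {k n : ℕ}

/-- The distance in the product of the batons with steps `lam i`, `i ∈ S`, between the points with
indices `j` and `j'`; the coordinates of `j` and `j'` outside `S` are ignored. -/
noncomputable def gridDist (lam : ι → ℝ) (S : Finset ι) (j j' : ι → Fin (k + 1)) : ℝ≥0 :=
  S.sup fun i => nndist ((j i : ℝ) * lam i) ((j' i : ℝ) * lam i)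

/-- The words of `A`, read in `ℝⁿ` through the letter values `v`, contain an isometric copy `p` of
the product of the batons with `k` gaps and steps `lam i`, `i ∈ S`. The copy is indexed by all of
`ι → Fin (k + 1)`, so that `S` can vary without a change of types. -/
def HasGridCopy (k : ℕ) (v : α → ℝ) (lam : ι → ℝ) (S : Finset ι) (A : Finset (Fin n → α)) :
    Prop :=
  ∃ p : (ι → Fin (k + 1)) → Fin n → α, (∀ j, p j ∈ A) ∧ DependsOn p S ∧
    ∀ j j', nndist (v ∘ p j) (v ∘ p j') = gridDist lam S j j'

theorem hasGridCopy_empty (v : α → ℝ) (lam : ι → ℝ) {A : Finset (Fin n → α)}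
    (hA : A.Nonempty) : HasGridCopy k v lam ∅ A := by
  obtain ⟨x, hx⟩ := hA
  exact ⟨fun _ => x, fun _ => hx, fun _ _ _ => rfl, by simp [gridDist]⟩

theorem nnnorm_le_nndist_natCast_mul {a b : ℕ} (hab : a ≠ b) (l : ℝ) :
    ‖l‖₊ ≤ nndist ((a : ℝ) * l) (b * l) := by
  have h1 : (1 : ℝ) ≤ |(a : ℝ) - b| := by
    exact_mod_cast Int.one_le_abs (sub_ne_zero.2 (Nat.cast_injective.ne hab))
  rw [← NNReal.coe_le_coe, coe_nndist, Real.dist_eq, ← sub_mul, abs_mul, coe_nnnorm,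
    Real.norm_eq_abs]
  exact le_mul_of_one_le_left (abs_nonneg l) h1

theorem nndist_comp_vecCons (v : α → ℝ) (a b : α) (x y : Fin n → α) :
    nndist (v ∘ Matrix.vecCons a x) (v ∘ Matrix.vecCons b y) =
      max (nndist (v a) (v b)) (nndist (v ∘ x) (v ∘ y)) := by
  have hcons (a : α) (x : Fin n → α) :
      v ∘ Matrix.vecCons a x = Fin.insertNth (α := fun _ => ℝ) 0 (v a) (v ∘ x) := by
    rw [Fin.insertNth_zero]
    exact Fin.comp_cons v a x
  rw [hcons, hcons, Fin.nndist_insertNth_insertNth]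

theorem HasGridCopy.exists_isometry [Fintype ι] {v : α → ℝ} {lam : ι → ℝ}
    {A : Finset (Fin n → α)} (h : HasGridCopy k v lam Finset.univ A) :
    ∃ g : ((i : ι) → arithBaton k (lam i)) → Fin n → ℝ,
      Isometry g ∧ ∀ y, ∃ a ∈ A, g y = v ∘ a := by
  obtain ⟨p, hpA, -, hp⟩ := h
  choose t ht using fun (i : ι) (y : arithBaton k (lam i)) => mem_arithBaton_iff.1 y.2
  refine ⟨fun y => v ∘ p fun i => t i (y i), Isometry.of_nndist_eq fun y y' => ?_,
    fun y => ⟨_, hpA _, rfl⟩⟩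
  rw [hp, nndist_pi_def]
  simp only [gridDist, ht, Subtype.nndist_eq]

variable [Fintype α] [DecidableEq α] {v : α → ℝ} {lam : ι → ℝ} {S : Finset ι}
  {A : Finset (Fin (n + 1) → α)}

theorem HasGridCopy.of_mergedFibre {a b : α}
    (hab : ∀ i ∈ S, nndist (v a) (v b) ≤ ‖lam i‖₊)
    (h : HasGridCopy k v lam S (mergedFibre A a b)) : HasGridCopy k v lam S A := by
  obtain ⟨p, hpA, hpS, hp⟩ := h
  have hletter (y : Fin n → α) :
      ∃ c, (c = a ∨ c = b) ∧ (y ∈ mergedFibre A a b → Matrix.vecCons c y ∈ A) := by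
    by_cases ha : Matrix.vecCons a y ∈ A
    · exact ⟨a, .inl rfl, fun _ => ha⟩
    · exact ⟨b, .inr rfl, fun hy => by simpa [mergedFibre, ha] using hy⟩
  choose c hc hcA using hletter
  refine ⟨fun j => Matrix.vecCons (c (p j)) (p j), fun j => hcA _ (hpA j),
    fun j j' hj => by simp only [hpS hj], fun j j' => ?_⟩
  rw [nndist_comp_vecCons, hp, max_eq_right]
  by_cases hj : ∀ i ∈ S, j i = j' i
  · simp [hpS hj]
  · obtain ⟨i, hi, hne⟩ : ∃ i ∈ S, j i ≠ j' i := by simpa using hj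
    calc nndist (v (c (p j))) (v (c (p j'))) ≤ nndist (v a) (v b) := by
          rcases hc (p j) with h | h <;> rcases hc (p j') with h' | h' <;>
            simp [h, h', nndist_comm]
      _ ≤ ‖lam i‖₊ := hab i hi
      _ ≤ nndist ((j i : ℝ) * lam i) ((j' i : ℝ) * lam i) :=
        nnnorm_le_nndist_natCast_mul (Fin.val_injective.ne hne) _
      _ ≤ gridDist lam S j j' :=
        Finset.le_sup (f := fun i => nndist ((j i : ℝ) * lam i) ((j' i : ℝ) * lam i)) hi

theorem HasGridCopy.of_fullFibre [DecidableEq ι] {i : ι} (hi : i ∈ S) {ℓ : Fin (k + 1) → α}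
    (hℓ : ∀ t t', nndist (v (ℓ t)) (v (ℓ t')) = nndist ((t : ℝ) * lam i) (t' * lam i))
    (h : HasGridCopy k v lam (S.erase i) (fullFibre A ℓ)) : HasGridCopy k v lam S A := by
  obtain ⟨p, hpA, hpS, hp⟩ := h
  refine ⟨fun j => Matrix.vecCons (ℓ (j i)) (p j), fun j => ?_, fun j j' hj => ?_,
    fun j j' => ?_⟩
  · exact (Finset.mem_filter.1 (hpA j)).2 (j i)
  · simp only [hpS fun i' hi' => hj i' (Finset.mem_of_mem_erase hi'), hj i hi]
  · rw [nndist_comp_vecCons, hp, hℓ]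
    conv_rhs => rw [gridDist, ← Finset.insert_erase hi, Finset.sup_insert]
    rfl

end GridCopy

section Density

variable {ι : Type*} [Fintype ι] {k n : ℕ}

/-- The letter `a ∈ {0, …, k}^ι` stands for the real number `∑ i, a i * lam i`; along each line
in direction `i` these values form a translate of the baton with step `lam i`. -/
def gridValue (lam : ι → ℝ) (a : ι → Fin (k + 1)) : ℝ :=
  ∑ i, (a i : ℝ) * lam i

theorem nndist_gridValue_funSplitAt_symm [DecidableEq ι] (lam : ι → ℝ) (i : ι)
    (b : {j // j ≠ i} → Fin (k + 1)) (t t' : Fin (k + 1)) :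
    nndist (gridValue lam ((Equiv.funSplitAt i _).symm (t, b)))
      (gridValue lam ((Equiv.funSplitAt i _).symm (t', b))) =
        nndist ((t : ℝ) * lam i) (t' * lam i) := by
  have hsplit (t : Fin (k + 1)) : gridValue lam ((Equiv.funSplitAt i _).symm (t, b)) =
      t * lam i + ∑ j : {j // j ≠ i}, (b j : ℝ) * lam j := by
    rw [gridValue, Fintype.sum_eq_add_sum_subtype_ne _ i]
    congr 1
    · simp [Equiv.funSplitAt]
    · exact Finset.sum_congr rfl fun j _ => by simp [Equiv.funSplitAt, j.2]
  rw [hsplit, hsplit, nndist_add_right]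

theorem pow_mul_card_le_of_not_hasGridCopy (hk : 0 < k) (lam : ι → ℝ) (S : Finset ι)
    (A : Finset (Fin n → ι → Fin (k + 1)))
    (hA : ¬ HasGridCopy k (gridValue lam) lam S A) :
    (k + 1) ^ n * A.card ≤ (k * (k + 1) ^ Fintype.card ι) ^ n * (n + 1) ^ S.card := by
  classical
  rw [show (k + 1) ^ Fintype.card ι = Fintype.card (ι → Fin (k + 1)) by simp]
  induction n generalizing S with
  | zero => simpa using A.card_le_univ
  | succ n ih =>
    obtain rfl | hS := S.eq_empty_or_nonempty
    · have : A = ∅ := Finset.not_nonempty_iff_eq_empty.1 fun h => hA (hasGridCopy_empty _ _ h)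
      simp [this]
    -- A step between neighbours in the direction of the smallest `lam i` is too short to be seen
    -- by the metric of a copy; a line in any other direction could not be merged.
    obtain ⟨i, hi, hmin⟩ := S.exists_min_image (fun i => ‖lam i‖₊) hS
    have hcard : (S.erase i).card + 1 = S.card := Finset.card_erase_add_one hi
    rw [← hcard]
    refine pow_mul_card_le_of_fibres_le hk (Equiv.funSplitAt i (Fin (k + 1))).symm
      (fun b t => ?_) (fun b => ?_)
    · rw [hcard]
      refine ih S _ fun h => hA (h.of_mergedFibre fun i' hi' => ?_)
      rw [nndist_gridValue_funSplitAt_symm]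
      refine le_of_eq_of_le ?_ (hmin i' hi')
      simp [nndist_eq_nnnorm, ← sub_mul]
    · exact ih (S.erase i) _ fun h =>
        hA (h.of_fullFibre hi (nndist_gridValue_funSplitAt_symm lam i b))

theorem pow_le_card_mul_of_isProperColouring {C : Type*} [Fintype C] (hk : 0 < k) {lam : ι → ℝ}
    {f : (Fin n → ℝ) → C} (hf : IsProperColouring ((i : ι) → arithBaton k (lam i)) f) :
    (k + 1) ^ n ≤ Fintype.card C * (k ^ n * (n + 1) ^ Fintype.card ι) := by
  classical
  rw [isProperColouring_iff_forall_isometry] at hf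
  set N := (k + 1) ^ Fintype.card ι
  let colourClass (c : C) : Finset (Fin n → ι → Fin (k + 1)) := {x | f (gridValue lam ∘ x) = c}
  have hclass (c : C) :
      (k + 1) ^ n * (colourClass c).card ≤ (k * N) ^ n * (n + 1) ^ Fintype.card ι := by
    refine pow_mul_card_le_of_not_hasGridCopy hk lam Finset.univ (colourClass c) fun h => ?_
    obtain ⟨g, hg, hgA⟩ := h.exists_isometry
    refine hf g hg ⟨c, fun y => ?_⟩
    obtain ⟨a, ha, hy⟩ := hgA y
    rw [hy]
    exact (Finset.mem_filter.1 ha).2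
  have hcard : N ^ n = ∑ c, (colourClass c).card := by
    rw [← Finset.card_eq_sum_card_fiberwise (f := fun x => f (gridValue lam ∘ x))
      fun _ _ => Finset.mem_coe.2 (Finset.mem_univ _)]
    simp [N]
  refine Nat.le_of_mul_le_mul_right ?_ (show 0 < N ^ n by positivity)
  calc (k + 1) ^ n * N ^ n = ∑ c, (k + 1) ^ n * (colourClass c).card := by
        rw [hcard, Finset.mul_sum]
    _ ≤ ∑ _c : C, (k * N) ^ n * (n + 1) ^ Fintype.card ι := Finset.sum_le_sum fun c _ => hclass c
    _ = Fintype.card C * (k ^ n * (n + 1) ^ Fintype.card ι) * N ^ n := by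
        rw [Finset.sum_const, Finset.card_univ, smul_eq_mul, mul_pow]
        ring

end Density

section Covering

theorem exists_cover_of_card_mul_pow_lt {P U : Type*} [Fintype P] [Fintype U] (R : P → U → Prop)
    [∀ p, DecidablePred (R p)] {b s : ℕ} (hb : ∀ p, Fintype.card {u // ¬ R p u} ≤ b)
    (hs : Fintype.card P * b ^ s < Fintype.card U ^ s) :
    ∃ T : Fin s → U, ∀ p, ∃ i, R p (T i) := by
  classical
  by_contra! h
  refine hs.not_ge ?_
  calc Fintype.card U ^ s = (Finset.univ : Finset (Fin s → U)).card := by simp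
    _ ≤ (Finset.univ.biUnion fun p =>
          Fintype.piFinset fun _ : Fin s => {u | ¬ R p u}).card := by
        refine Finset.card_le_card fun T _ => ?_
        obtain ⟨p, hp⟩ := h T
        simpa using ⟨p, hp⟩
    _ ≤ Fintype.card P * b ^ s := by
        refine Finset.card_biUnion_le_card_mul _ _ _ fun p _ => ?_
        rw [Fintype.card_piFinset_const, ← Fintype.card_subtype]
        exact Nat.pow_le_pow_left (hb p) s

theorem mul_sub_pow_lt_pow_of_log_lt {P N d s : ℕ} (hN : 0 < N) (hdN : d ≤ N)
    (h : Real.log P < s * (d / N)) : P * (N - d) ^ s < N ^ s := by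
  obtain rfl | hP := P.eq_zero_or_pos
  · simpa using pow_pos hN s
  have hN' : (0 : ℝ) < N := by exact_mod_cast hN
  have hP' : (0 : ℝ) < P := by exact_mod_cast hP
  have hd : (d : ℝ) / N ≤ 1 := div_le_one_of_le₀ (by exact_mod_cast hdN) hN'.le
  have hprob : (P : ℝ) * (1 - d / N) ^ s < 1 := by
    calc (P : ℝ) * (1 - d / N) ^ s ≤ P * Real.exp (-(d / N)) ^ s := by
          have := Real.one_sub_le_exp_neg ((d : ℝ) / N)
          have := sub_nonneg.2 hd
          gcongr
      _ = Real.exp (Real.log P - s * (d / N)) := by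
          rw [← Real.exp_nat_mul, sub_eq_add_neg, Real.exp_add, Real.exp_log hP', mul_neg]
      _ < 1 := Real.exp_lt_one_iff.2 (sub_neg.2 h)
  have hsplit : (N : ℝ) - d = N * (1 - d / N) := by field_simp
  rify [hdN]
  rw [hsplit, mul_pow, mul_left_comm]
  exact mul_lt_of_lt_one_right (pow_pos hN' s) hprob

theorem floor_mul_log_add_one_le {r : ℝ} (hr : 1 ≤ r) (k n : ℕ) :
    (⌊r * (n * Real.log (k + 1))⌋₊ + 1 : ℝ) ≤ r * (n + 1) ^ k := by
  have hlog : Real.log ((k : ℝ) + 1) ≤ k := by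
    simpa using Real.log_le_sub_one_of_pos (show (0 : ℝ) < (k : ℝ) + 1 by positivity)
  have hlog0 : 0 ≤ Real.log ((k : ℝ) + 1) := Real.log_nonneg (by simp)
  calc (⌊r * (n * Real.log (k + 1))⌋₊ + 1 : ℝ) ≤ r * (n * Real.log (k + 1)) + 1 := by
        gcongr
        exact Nat.floor_le (by positivity)
    _ ≤ r * (n * k) + r := by gcongr
    _ = r * (1 + k * n) := by ring
    _ ≤ r * (1 + n) ^ k := by
        gcongr
        exact one_add_mul_le_pow (le_trans (by norm_num) n.cast_nonneg) k
    _ = r * (n + 1) ^ k := by rw [add_comm (1 : ℝ)]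

theorem exists_words_forall_exists_ne {α : Type*} [Fintype α] {k : ℕ} (hk : 0 < k)
    (hα : Fintype.card α = k + 1) (n : ℕ) :
    ∃ s : ℕ, (s : ℝ) ≤ (((k : ℝ) + 1) / k) ^ n * (n + 1) ^ k ∧
      ∃ T : Fin s → Fin n → α, ∀ z : Fin n → α, ∃ i, ∀ j, z j ≠ T i j := by
  classical
  have hk' : (0 : ℝ) < k := by exact_mod_cast hk
  set r : ℝ := (((k : ℝ) + 1) / k) ^ n
  have hr : 1 ≤ r := one_le_pow₀ ((one_le_div hk').2 (by simp))
  have hle : k ^ n ≤ (k + 1) ^ n := Nat.pow_le_pow_left k.le_succ n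
  have hwords : Fintype.card (Fin n → α) = (k + 1) ^ n := by simp [hα]
  have havoid (z : Fin n → α) : Fintype.card {u : Fin n → α // ∀ j, z j ≠ u j} = k ^ n := by
    have : ({u : Fin n → α | ∀ j, z j ≠ u j} : Finset _) =
        Fintype.piFinset fun j => Finset.univ.erase (z j) := by
      ext u
      simp [eq_comm]
    rw [Fintype.card_subtype, this, Fintype.card_piFinset]
    simp [hα]
  refine ⟨⌊r * (n * Real.log (k + 1))⌋₊ + 1, ?_, ?_⟩
  · exact_mod_cast floor_mul_log_add_one_le hr k n
  · refine exists_cover_of_card_mul_pow_lt (fun z u : Fin n → α => ∀ j, z j ≠ u j)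
      (b := (k + 1) ^ n - k ^ n) (fun z => ?_) ?_
    · rw [Fintype.card_subtype_compl, hwords, havoid]
    · rw [hwords]
      refine mul_sub_pow_lt_pow_of_log_lt (by positivity) hle ?_
      have hdensity : (((k ^ n : ℕ) : ℝ) / ((k + 1) ^ n : ℕ)) = r⁻¹ := by
        push_cast
        rw [← div_pow, ← inv_div, inv_pow]
      rw [hdensity, ← div_eq_mul_inv, lt_div_iff₀ (by positivity), mul_comm]
      push_cast
      rw [Real.log_pow]
      exact Nat.lt_floor_add_one _

end Covering

section Colouring

variable {k : ℕ}

theorem exists_mem_Ico_of_floor_ne {x : ℝ} {u : ZMod (k + 1)} (h : (⌊x⌋ : ZMod (k + 1)) ≠ u) :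
    ∃ b : ℤ, x ∈ Set.Ico ((u.val + 1 : ℝ) + b * (k + 1)) ((u.val + 1 : ℝ) + b * (k + 1) + k) := by
  set r := (⌊x⌋ - u.val) % ((k : ℤ) + 1)
  have hr0 : r ≠ 0 := by
    contrapose! h
    have hdvd := (ZMod.intCast_zmod_eq_zero_iff_dvd (⌊x⌋ - u.val) (k + 1)).2
      (by exact_mod_cast Int.dvd_of_emod_eq_zero h)
    simpa [sub_eq_zero] using hdvd
  have hr1 : 1 ≤ r := by
    have : 0 ≤ r := Int.emod_nonneg _ (by positivity)
    omega
  have hrk : r ≤ k := Int.lt_add_one_iff.1 (Int.emod_lt_of_pos _ (by positivity))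
  have hx := Int.emod_add_mul_ediv (⌊x⌋ - u.val) ((k : ℤ) + 1)
  refine ⟨(⌊x⌋ - u.val) / ((k : ℤ) + 1), ?_⟩
  have hfloor : (⌊x⌋ : ℝ) =
      u.val + r + ((⌊x⌋ - u.val) / ((k : ℤ) + 1) : ℤ) * ((k : ℝ) + 1) := by
    have : ⌊x⌋ = u.val + r + ((⌊x⌋ - u.val) / ((k : ℤ) + 1)) * ((k : ℤ) + 1) := by linarith
    exact_mod_cast this
  have hr1' : (1 : ℝ) ≤ r := by exact_mod_cast hr1
  have hrk' : (r : ℝ) ≤ k := by exact_mod_cast hrk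
  constructor <;> linarith [Int.floor_le x, Int.lt_floor_add_one x]

theorem le_of_mem_Ico_of_le_add_one {c x y : ℝ} {b b' : ℤ} (hxy : y ≤ x + 1)
    (hx : x ∈ Set.Ico (c + b * (k + 1)) (c + b * (k + 1) + k))
    (hy : y ∈ Set.Ico (c + b' * (k + 1)) (c + b' * (k + 1) + k)) : b' ≤ b := by
  by_contra! h
  have hb : (b : ℝ) + 1 ≤ b' := by exact_mod_cast h
  have := mul_le_mul_of_nonneg_right hb (show (0 : ℝ) ≤ k + 1 by positivity)
  linarith [hx.2, hy.1]

theorem abs_sub_lt_of_floor_ne {N : ℕ} {x : Fin (N + 1) → ℝ} {u : ZMod (k + 1)}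
    (hstep : ∀ a : Fin N, |x a.succ - x a.castSucc| ≤ 1)
    (hu : ∀ a, (⌊x a⌋ : ZMod (k + 1)) ≠ u) (a a' : Fin (N + 1)) : |x a - x a'| < k := by
  choose b hb using fun a => exists_mem_Ico_of_floor_ne (hu a)
  have hb0 (a : Fin (N + 1)) : b a = b 0 := by
    induction a using Fin.induction with
    | zero => rfl
    | succ a ih =>
      have h := abs_le.1 (hstep a)
      exact ih ▸ le_antisymm (le_of_mem_Ico_of_le_add_one (by linarith) (hb _) (hb _))
        (le_of_mem_Ico_of_le_add_one (by linarith) (hb _) (hb _))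
  have h := hb a
  have h' := hb a'
  rw [hb0] at h h'
  rw [abs_lt]
  constructor <;> linarith [h.1, h.2, h'.1, h'.2]

theorem isProperColouring_arithBaton_of_floor_ne {C : Type*} {n : ℕ} (hk : 0 < k)
    {l : ℝ} (hl : l ≠ 0) {f : (Fin n → ℝ) → C} (T : C → Fin n → ZMod (k + 1))
    (hf : ∀ x j, (⌊x j / l⌋ : ZMod (k + 1)) ≠ T (f x) j) :
    IsProperColouring (arithBaton k l) f := by
  rw [isProperColouring_iff_forall_isometry]
  rintro g hg ⟨c, hc⟩
  let point (t : Fin (k + 1)) : arithBaton k l := ⟨t * l, mem_arithBaton_iff.2 ⟨t, rfl⟩⟩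
  have hdist (t t' : Fin (k + 1)) : dist (g (point t)) (g (point t')) = |(t : ℝ) - t'| * |l| := by
    rw [hg.dist_eq, Subtype.dist_eq, Real.dist_eq, ← sub_mul, abs_mul]
  have hl' : 0 < |l| := abs_pos.2 hl
  have hspan : dist (g (point (Fin.last k))) (g (point 0)) < k * |l| := by
    refine (dist_pi_lt_iff (by positivity)).2 fun j => ?_
    have hcoord := abs_sub_lt_of_floor_ne (x := fun t => g (point t) j / l) (u := T c j)
      (fun t => ?_) (fun t => hc (point t) ▸ hf (g (point t)) j) (Fin.last k) 0
    · rwa [← sub_div, abs_div, div_lt_iff₀ hl'] at hcoord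
    · rw [← sub_div, abs_div, div_le_one hl', ← Real.dist_eq]
      refine (dist_le_pi_dist _ _ j).trans ?_
      rw [hdist]
      simp
  rw [hdist] at hspan
  simp at hspan

theorem exists_isProperColouring_arithBaton (hk : 0 < k) {l : ℝ} (hl : l ≠ 0) (n : ℕ) :
    ∃ s : ℕ, (s : ℝ) ≤ (((k : ℝ) + 1) / k) ^ n * (n + 1) ^ k ∧
      ∃ f : (Fin n → ℝ) → Fin s, IsProperColouring (arithBaton k l) f := by
  obtain ⟨s, hs, T, hT⟩ := exists_words_forall_exists_ne hk (ZMod.card (k + 1)) n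
  choose f hf using fun x : Fin n → ℝ => hT fun j => (⌊x j / l⌋ : ZMod (k + 1))
  exact ⟨s, hs, f, isProperColouring_arithBaton_of_floor_ne hk hl T hf⟩

end Colouring

section Asymptotics

theorem tendsto_mul_natCast_add_one_rpow_div (r a : ℝ) :
    Tendsto (fun n : ℕ => r * ((n : ℝ) + 1) ^ (a / n)) atTop (𝓝 r) := by
  have h := (tendsto_rpow_div_mul_add a 1 (-1) one_ne_zero.symm).comp
    (tendsto_atTop_add_const_right atTop (1 : ℝ) (tendsto_natCast_atTop_atTop (R := ℝ)))
  simpa using (h.congr fun n => by simp).const_mul r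

theorem tendsto_rpow_inv_of_le_of_le {r : ℝ} (hr : 0 < r) {c : ℕ → ℝ} {d e : ℕ}
    (hlower : ∀ n, r ^ n ≤ c n * ((n : ℝ) + 1) ^ d)
    (hupper : ∀ n, c n ≤ r ^ n * ((n : ℝ) + 1) ^ e) :
    Tendsto (fun n : ℕ => c n ^ (n : ℝ)⁻¹) atTop (𝓝 r) := by
  have hroot {n : ℕ} (hn : n ≠ 0) (a : ℝ) :
      r * ((n : ℝ) + 1) ^ (a / n) = (r ^ n * ((n : ℝ) + 1) ^ a) ^ (n : ℝ)⁻¹ := by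
    rw [Real.mul_rpow (by positivity) (by positivity), Real.pow_rpow_inv_natCast hr.le hn,
      ← Real.rpow_mul (by positivity), div_eq_mul_inv]
  have hlower' (n : ℕ) : r ^ n * ((n : ℝ) + 1) ^ (-(d : ℝ)) ≤ c n := by
    rw [Real.rpow_neg (by positivity), Real.rpow_natCast, ← div_eq_mul_inv,
      div_le_iff₀ (by positivity)]
    exact hlower n
  refine tendsto_of_tendsto_of_tendsto_of_le_of_le'
    (tendsto_mul_natCast_add_one_rpow_div r (-d)) (tendsto_mul_natCast_add_one_rpow_div r e) ?_ ?_
  · filter_upwards [eventually_ne_atTop 0] with n hn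
    rw [hroot hn]
    exact Real.rpow_le_rpow (by positivity) (hlower' n) (by positivity)
  · filter_upwards [eventually_ne_atTop 0] with n hn
    rw [hroot hn, Real.rpow_natCast]
    exact Real.rpow_le_rpow (le_trans (by positivity) (hlower' n)) (hupper n) (by positivity)

theorem exists_tendsto_zero_eq_add_pow {r : ℝ} (hr : 0 < r) {c : ℕ → ℝ} {d e : ℕ}
    (hlower : ∀ n, r ^ n ≤ c n * ((n : ℝ) + 1) ^ d)
    (hupper : ∀ n, c n ≤ r ^ n * ((n : ℝ) + 1) ^ e) :
    ∃ o : ℕ → ℝ, Tendsto o atTop (𝓝 0) ∧ ∀ n, c n = (r + o n) ^ n := by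
  refine ⟨fun n => c n ^ (n : ℝ)⁻¹ - r, ?_, fun n => ?_⟩
  · simpa using (tendsto_rpow_inv_of_le_of_le hr hlower hupper).sub_const r
  · have hc : 0 ≤ c n :=
      nonneg_of_mul_nonneg_left ((pow_pos hr n).le.trans (hlower n)) (by positivity)
    obtain rfl | hn := eq_or_ne n 0
    · exact le_antisymm (by simpa using hupper 0) (by simpa using hlower 0)
    · rw [add_sub_cancel, Real.rpow_inv_natCast_pow hc hn]

end Asymptotics

-- The case to have in mind: `Y` is a product of arithmetic batons with various numbers of gaps, of
-- which `k` is the largest.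
theorem theorem5_general {ι Y : Type*} [Fintype ι] [MetricSpace Y] {k : ℕ} (hk : 1 ≤ k) {l : ℝ}
    (hl : l ≠ 0) {g : arithBaton k l → Y} (hg : Isometry g) {lam : ι → ℝ}
    {h : Y → (i : ι) → arithBaton k (lam i)} (hh : Isometry h) :
    (∀ n : ℕ, chromaticNumber (Fin n → ℝ) Y ≠ ⊤) ∧
      ∃ o : ℕ → ℝ, Tendsto o atTop (𝓝 0) ∧
        ∀ n : ℕ, ((chromaticNumber (Fin n → ℝ) Y).toNat : ℝ) = (((k : ℝ) + 1) / k + o n) ^ n := by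
  have : (0 : ℝ) < k := by exact_mod_cast hk
  have hcolouring (n : ℕ) : ∃ s : ℕ, (s : ℝ) ≤ (((k : ℝ) + 1) / k) ^ n * (n + 1) ^ k ∧
      chromaticNumber (Fin n → ℝ) Y ≤ s := by
    obtain ⟨s, hs, f, hf⟩ := exists_isProperColouring_arithBaton hk hl n
    exact ⟨s, hs, chromaticNumber_le (hf.of_isometry hg)⟩
  have hfinite (n : ℕ) : chromaticNumber (Fin n → ℝ) Y ≠ ⊤ := by
    obtain ⟨s, -, hle⟩ := hcolouring n
    exact ne_top_of_le_ne_top (ENat.natCast_ne_top s) hle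
  refine ⟨hfinite, exists_tendsto_zero_eq_add_pow (d := Fintype.card ι) (e := k)
    (by positivity) (fun n => ?_) (fun n => ?_)⟩
  · obtain ⟨f, hf⟩ := exists_isProperColouring_toNat_chromaticNumber (hfinite n)
    have hcount := pow_le_card_mul_of_isProperColouring hk (hf.of_isometry hh)
    rw [Fintype.card_fin] at hcount
    rw [div_pow, div_le_iff₀ (by positivity), mul_right_comm, mul_assoc]
    exact_mod_cast hcount
  · obtain ⟨s, hs, hle⟩ := hcolouring n
    exact (Nat.cast_le.2 (ENat.toNat_le_of_le_natCast hle)).trans hs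

theorem theorem5 (k m : ℕ) (hk : 1 ≤ k) (hm : 1 ≤ m) (lam : Fin m → ℝ) (hlam : ∀ i, 0 < lam i) :
    (∀ n : ℕ, chromaticNumber (Fin n → ℝ) ((i : Fin m) → arithBaton k (lam i)) ≠ ⊤) ∧
      ∃ o : ℕ → ℝ, Filter.Tendsto o Filter.atTop (nhds 0) ∧
        ∀ n : ℕ,
          ((chromaticNumber (Fin n → ℝ) ((i : Fin m) → arithBaton k (lam i))).toNat : ℝ) =
            (((k : ℝ) + 1) / k + o n) ^ n := by
  obtain ⟨g, hg⟩ := exists_isometry_arithBaton_pi k lam ⟨0, hm⟩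
  exact theorem5_general hk (hlam ⟨0, hm⟩).ne' hg isometry_id
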